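/- Let $A\in\mathbb R^{n\times n}$ and $C\in\mathbb R^{m\times m}$ be row-stochastic matrices, let $\lambda^1,\dots,\lambda^n\in[0,1]$, $\Lambda=\operatorname{diag}(\lambda^1,\dots,\lambda^n)$, and let $$P=\begin{pmatrix}(\Lambda A)\otimes C & (I_n-\Lambda)\otimes I_m\\ 0& I_{nm}\end{pmatrix}$$ be the ($2nm\times 2nm$, row-stochastic) matrix of the belief system $x_{k+1}=Px_k$. Let $\mathcal P$ be the directed graph on the $2nm$ indices with an edge from $\ell$ to $r$ if and only if $P_{r\ell}>0$. A strongly connected component of $\mathcal P$ is called closed if no edge enters it from a node outside of it, and aperiodic if the greatest common divisor of the lengths of the cycles inside it is $1$. A random walk started at a node $i$ is the Markov chain with transition matrix $P$ and $X_0=i$. Suppose that all closed strongly connected components of $\mathcal P$ are aperiodic. Let $$L=\max_{S}\max_{u,v\in S}\mathbb E\bigl[\min\{k\ge 0: X_k=Y_k\}\bigr],$$ where $S$ ranges over the closed strongly connected components and $X,Y$ are independent random walks with $X_0=u$, $Y_0=v$, and let $$H=\max_{i}\ \mathbb E\bigl[\min\{k\ge 0: X_k \text{ lies in a closed strongly connected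 component}\}\bigr],$$ where $i$ ranges over all nodes and $X$ is the random walk with $X_0=i$. For vectors $\mu,\nu$ indexed by the nodes write $\|\mu-\nu\|_{TV}=\sup_{B}|\mu(B)-\nu(B)|$, the supremum being over all sets $B$ of nodes, where $\mu(B)=\sum_{i\in B}\mu_i$. Then $L$ and $H$ are finite, and the following hold. 1. For every probability vector $v$ on the nodes (in particular for the point mass at any node), the distributions $v'P^k$ of the random walk converge as $k\to\infty$ to a limit $v_\infty'$, and $\|v'P^k-v_\infty'\|_{TV}\le\varepsilon$ for all $0<\varepsilon\le\tfrac12$ and all integers $k\ge 4(L+H)\log(1/\varepsilon)$. 2. For every $x_0\in[0,1]^{2nm}$, the beliefs $x_k=P^kx_0$ converge to a limit $x_\infty$, and every node is within $\varepsilon$ of its limiting value, $|x_k^i-x_\infty^i|\le\varepsilon$ for all $i$, for all $0<\varepsilon\le\tfrac12$ and all integers $k\ge 4(L+H)\log(1/\varepsilon)$. -/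

import Mathlib

open scoped Matrix Kronecker ENNReal
open MeasureTheory ProbabilityTheory Filter Topology

namespace BeliefSystem

/-! ### Directed graphs -/

section Graph

variable {V : Type*}

/-- The directed graph of a square matrix `P`, with an edge from `l` to `r` exactly when
`P r l > 0`; a random walk with transition matrix `P` traverses the edges backwards. -/
def matrixGraph (P : Matrix V V ℝ) : Digraph V where
  Adj l r := 0 < P r l

/-- There is a directed path (possibly of length zero) from `i` to `j`. -/
def HasPath (G : Digraph V) (i j : V) : Prop :=
  Relation.ReflTransGen G.Adj i j

/-- `S` is a strongly connected component of `G`: a class of mutual reachability. -/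
def IsStrongComponent (G : Digraph V) (S : Set V) : Prop :=
  ∃ i, S = {j | HasPath G i j ∧ HasPath G j i}

/-- `S` is a strongly connected component of `G` without incoming edges from other nodes. -/
def IsClosedComponent (G : Digraph V) (S : Set V) : Prop :=
  IsStrongComponent G S ∧ ∀ l, l ∉ S → ∀ r ∈ S, ¬ G.Adj l r

/-- The lengths of the cycles (closed paths) of the subgraph of `G` induced by `S`. -/
def cycleLengths (G : Digraph V) (S : Set V) : Set ℕ :=
  {l | ∃ p : Fin (l + 1) → V, (∀ t, p t ∈ S) ∧
    (∀ t : Fin l, G.Adj (p t.castSucc) (p t.succ)) ∧ p 0 = p (Fin.last l)}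

/-- The period of the subgraph induced by `S`, that is, the greatest common divisor of the lengths
of its cycles, equals one. -/
def IsAperiodic (G : Digraph V) (S : Set V) : Prop :=
  ∀ d : ℕ, (∀ l ∈ cycleLengths G S, d ∣ l) → d = 1

end Graph

/-! ### Random walks -/

section Walk

variable {V : Type*} [Fintype V] [DecidableEq V]

/-- The row `P i ·` of a row-stochastic matrix as a probability mass function. -/
noncomputable def rowPMF (P : Matrix V V ℝ) (hP : P ∈ Matrix.rowStochastic ℝ V) (i : V) : PMF V :=
  PMF.ofFintype (fun j => ENNReal.ofReal (P i j)) (by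
    rw [← ENNReal.ofReal_sum_of_nonneg
      (fun j _ => Matrix.nonneg_of_mem_rowStochastic hP),
      Matrix.sum_row_of_mem_rowStochastic hP, ENNReal.ofReal_one])

variable [MeasurableSpace V] [MeasurableSingletonClass V]

/-- The one-step transition kernel `i ↦ P i ·`. -/
noncomputable def stepKernel (P : Matrix V V ℝ) (hP : P ∈ Matrix.rowStochastic ℝ V) :
    Kernel V V :=
  Kernel.ofFunOfCountable fun i => (rowPMF P hP i).toMeasure

instance (P : Matrix V V ℝ) (hP : P ∈ Matrix.rowStochastic ℝ V) :
    IsMarkovKernel (stepKernel P hP) :=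
  ⟨fun i => PMF.toMeasure.isProbabilityMeasure (rowPMF P hP i)⟩

/-- The transition kernel from the history `(X 0, …, X t)` to `X (t + 1)`: it only looks
at the current state `X t`. -/
noncomputable def historyKernel (P : Matrix V V ℝ) (hP : P ∈ Matrix.rowStochastic ℝ V) (t : ℕ) :
    Kernel (Π _ : Finset.Iic t, V) V :=
  (stepKernel P hP).comap (fun h => h ⟨t, Finset.mem_Iic.2 le_rfl⟩) (measurable_pi_apply _)

instance (P : Matrix V V ℝ) (hP : P ∈ Matrix.rowStochastic ℝ V) (t : ℕ) :
    IsMarkovKernel (historyKernel P hP t) := by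
  unfold historyKernel; infer_instance

/-- The law, on the space of trajectories `ℕ → V`, of the random walk (Markov chain) with
transition matrix `P` started at the node `i`. -/
noncomputable def walkLaw (P : Matrix V V ℝ) (hP : P ∈ Matrix.rowStochastic ℝ V) (i : V) :
    Measure (ℕ → V) :=
  Kernel.trajMeasure (X := fun _ => V) (Measure.dirac i) (historyKernel P hP)

instance (P : Matrix V V ℝ) (hP : P ∈ Matrix.rowStochastic ℝ V) (i : V) :
    IsProbabilityMeasure (walkLaw P hP i) := by
  unfold walkLaw; infer_instance

/-- The first time `k ≥ 0` at which two trajectories agree (`∞` if they never do). -/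
noncomputable def couplingTime (X Y : ℕ → V) : ℝ≥0∞ :=
  ⨅ (k : ℕ) (_ : X k = Y k), (k : ℝ≥0∞)

/-- The first time `k ≥ 0` at which a trajectory is in a closed strongly connected component of `G`
(`∞` if it never is). -/
noncomputable def absorptionTime (G : Digraph V) (X : ℕ → V) : ℝ≥0∞ :=
  ⨅ (k : ℕ) (_ : ∃ S, IsClosedComponent G S ∧ X k ∈ S), (k : ℝ≥0∞)

/-- `L`: the maximum, over the closed strongly connected components `S` of the graph of `P` and over
`u, v ∈ S`, of the expected coupling time of two independent random walks started at `u`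
and `v`. -/
noncomputable def maxCouplingTime (P : Matrix V V ℝ) (hP : P ∈ Matrix.rowStochastic ℝ V) : ℝ≥0∞ :=
  ⨆ (S : Set V) (_ : IsClosedComponent (matrixGraph P) S) (u ∈ S) (v ∈ S),
    ∫⁻ ω, couplingTime ω.1 ω.2 ∂((walkLaw P hP u).prod (walkLaw P hP v))

/-- `H`: the maximum, over all starting nodes, of the expected time at which the random walk gets
absorbed into a closed strongly connected component of the graph of `P`. -/
noncomputable def maxAbsorptionTime (P : Matrix V V ℝ) (hP : P ∈ Matrix.rowStochastic ℝ V) :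
    ℝ≥0∞ :=
  ⨆ i : V, ∫⁻ X, absorptionTime (matrixGraph P) X ∂(walkLaw P hP i)

end Walk

/-- Total variation distance of two distributions on a finite set: the supremum over all events `B`
of `|μ B - ν B|`. -/
noncomputable def tvDist {V : Type*} (μ ν : V → ℝ) : ℝ :=
  ⨆ B : Finset V, |∑ i ∈ B, μ i - ∑ i ∈ B, ν i|

/-! ### The belief system -/

section System

variable {n m : ℕ}

/-- The nodes of the belief system of `n` agents and `m` statements: `Sum.inl (i, u)` is the current
belief of agent `i` on statement `u`, and `Sum.inr (i, u)` its initial belief. -/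
abbrev Node (n m : ℕ) : Type := (Fin n × Fin m) ⊕ (Fin n × Fin m)

instance : MeasurableSingletonClass (Node n m) where
  measurableSet_singleton x := by
    rcases x with x | x
    · rw [← Set.image_singleton]
      exact MeasurableSet.inl_image (measurableSet_singleton x)
    · rw [← Set.image_singleton]
      exact MeasurableSet.inr_image (measurableSet_singleton x)

/-- The system matrix with block rows `(Λ A) ⊗ C`, `(I - Λ) ⊗ I` and `0`, `I`,
where `Λ` is the diagonal matrix with diagonal `lam`. -/
noncomputable def systemMatrix (A : Matrix (Fin n) (Fin n) ℝ) (C : Matrix (Fin m) (Fin m) ℝ)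
    (lam : Fin n → ℝ) : Matrix (Node n m) (Node n m) ℝ :=
  Matrix.fromBlocks ((Matrix.diagonal lam * A) ⊗ₖ C)
    ((1 - Matrix.diagonal lam) ⊗ₖ (1 : Matrix (Fin m) (Fin m) ℝ)) 0 1

theorem systemMatrix_mem {A : Matrix (Fin n) (Fin n) ℝ} {C : Matrix (Fin m) (Fin m) ℝ}
    {lam : Fin n → ℝ} (hA : A ∈ Matrix.rowStochastic ℝ (Fin n))
    (hC : C ∈ Matrix.rowStochastic ℝ (Fin m)) (hlam : ∀ i, lam i ∈ Set.Icc (0 : ℝ) 1) :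
    systemMatrix A C lam ∈ Matrix.rowStochastic ℝ (Node n m) := by
  rw [Matrix.mem_rowStochastic_iff_sum] at hA hC ⊢
  have h0 : ∀ i j : Fin n, 0 ≤ ((1 : Matrix (Fin n) (Fin n) ℝ) - Matrix.diagonal lam) i j := by
    intro i j
    by_cases h : i = j
    · subst h; simpa using (hlam i).2
    · simp [h]
  have hone : ∀ (k : ℕ) (i j : Fin k), (0 : ℝ) ≤ (1 : Matrix (Fin k) (Fin k) ℝ) i j := by
    intro k i j; rw [Matrix.one_apply]; split_ifs <;> norm_num
  constructor
  · rintro (⟨i, u⟩ | ⟨i, u⟩) (⟨j, v⟩ | ⟨j, v⟩)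
    · simp only [systemMatrix, Matrix.fromBlocks_apply₁₁, Matrix.kronecker_apply,
        Matrix.diagonal_mul]
      exact mul_nonneg (mul_nonneg (hlam i).1 (hA.1 i j)) (hC.1 u v)
    · simp only [systemMatrix, Matrix.fromBlocks_apply₁₂, Matrix.kronecker_apply]
      exact mul_nonneg (h0 i j) (hone m u v)
    · simp [systemMatrix]
    · simp only [systemMatrix, Matrix.fromBlocks_apply₂₂, Matrix.one_apply]
      split_ifs <;> norm_num
  · rintro (⟨i, u⟩ | ⟨i, u⟩)
    · simp only [systemMatrix, Fintype.sum_sum_type, Matrix.fromBlocks_apply₁₁,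
        Matrix.fromBlocks_apply₁₂, Matrix.kronecker_apply, Matrix.diagonal_mul,
        Fintype.sum_prod_type, ← Finset.mul_sum, hC.2, hA.2, mul_one, Matrix.one_apply]
      simp [Matrix.one_apply, Matrix.diagonal_apply]
    · simp [systemMatrix, Matrix.one_apply]

end System

end BeliefSystem

open BeliefSystem

/-! The argument is a coupling with restarts, and it works for every finite row-stochastic matrix
`P`. It shows that `P ^ (k + n) *ᵥ x` and `P ^ k *ᵥ x` are close, uniformly in `n`, for every vector
`x` with entries in `[0,1]`.

Two walks from `i`, one of which has `n` extra steps to make, move together until they reach a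
recurrent node `u`. There the longer walk spends its `n` extra steps, landing on some `v` in the
same closed component, since walks cannot leave it. From `(u, v)` both move independently until they
meet. The probability `uncoupled P n k i` of not having met by time `k` bounds the difference of the
two entries at `i` (`abs_pow_add_mulVec_sub_le`). The expected meeting time is at most `L + H`
whatever `n` is (`sum_uncoupled_le`).

By Markov's inequality a block of `t` steps fails with probability at most `(L + H) / (t + 1)`, from
any state of the coupling. Restarting gives the `j`-th power after `j * t` steps
(`uncoupled_mul_le_pow`), and `exists_restart_schedule` picks `j` and `t` to reach `ε`. The bound is
uniform in `n`, so the sequence is Cauchy and the rate passes to the limit. Total variation is the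
dual statement, with indicators of events as `x`.

`L` and `H` enter as sums of survival probabilities, of the pair chain `P ⊗ₖ P` avoiding the
diagonal and of `P` avoiding the recurrent nodes. They are finite because the target is reachable
from every relevant state of a finite chain, so survival decays geometrically. For pairs,
reachability needs aperiodicity. -/

namespace BeliefSystem

/-! ### Survival probabilities of finite chains and their geometric decay -/

section Survival

variable {W : Type*} [Fintype W]

open scoped Classical in
/-- The probability that the random walk with transition matrix `Q` started at `x` avoids `T`
at the times `0, …, k`. -/
noncomputable def survival (Q : Matrix W W ℝ) (T : Set W) : ℕ → W → ℝ
  | 0, x => if x ∈ T then 0 else 1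
  | k + 1, x => if x ∈ T then 0 else ∑ y, Q x y * survival Q T k y

variable {Q : Matrix W W ℝ} {T : Set W}

theorem survival_of_mem {x : W} (hx : x ∈ T) (k : ℕ) : survival Q T k x = 0 := by
  cases k <;> simp [survival, hx]

theorem survival_zero {x : W} (hx : x ∉ T) : survival Q T 0 x = 1 := by
  simp [survival, hx]

theorem survival_succ {x : W} (hx : x ∉ T) (k : ℕ) :
    survival Q T (k + 1) x = ∑ y, Q x y * survival Q T k y := by
  simp [survival, hx]

theorem survival_nonneg (hQ : ∀ x y, 0 ≤ Q x y) (k : ℕ) (x : W) : 0 ≤ survival Q T k x := by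
  induction k generalizing x with
  | zero => by_cases hx : x ∈ T <;> simp [survival, hx]
  | succ k ih =>
    by_cases hx : x ∈ T
    · simp [survival, hx]
    · rw [survival_succ hx]
      exact Finset.sum_nonneg fun y _ => mul_nonneg (hQ x y) (ih y)

theorem survival_succ_le (hQ : ∀ x y, 0 ≤ Q x y) (hsum : ∀ x, ∑ y, Q x y = 1) (k : ℕ) (x : W) :
    survival Q T (k + 1) x ≤ survival Q T k x := by
  induction k generalizing x with
  | zero =>
    by_cases hx : x ∈ T
    · simp [survival, hx]
    · rw [survival_succ hx, survival_zero hx, ← hsum x]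
      refine Finset.sum_le_sum fun y _ => mul_le_of_le_one_right (hQ x y) ?_
      by_cases hy : y ∈ T <;> simp [survival, hy]
  | succ k ih =>
    by_cases hx : x ∈ T
    · simp [survival, hx]
    · rw [survival_succ hx, survival_succ hx]
      exact Finset.sum_le_sum fun y _ => mul_le_mul_of_nonneg_left (ih y) (hQ x y)

theorem survival_antitone (hQ : ∀ x y, 0 ≤ Q x y) (hsum : ∀ x, ∑ y, Q x y = 1) (x : W) :
    Antitone fun k => survival Q T k x :=
  antitone_nat_of_succ_le fun k => survival_succ_le hQ hsum k x

theorem survival_le_one (hQ : ∀ x y, 0 ≤ Q x y) (hsum : ∀ x, ∑ y, Q x y = 1) (k : ℕ) (x : W) :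
    survival Q T k x ≤ 1 := by
  refine (survival_antitone hQ hsum x (Nat.zero_le k)).trans ?_
  by_cases hx : x ∈ T <;> simp [survival, hx]

/-- A bound on the survival probability up to time `m`, uniform over an invariant set, applies
again after any time `k`. -/
theorem survival_add_le (hQ : ∀ x y, 0 ≤ Q x y) {I : Set W}
    (hI : ∀ x ∈ I, ∀ y, Q x y ≠ 0 → y ∈ I) {m : ℕ} {b : ℝ}
    (hb : ∀ x ∈ I, survival Q T m x ≤ b) (k : ℕ) {x : W} (hx : x ∈ I) :
    survival Q T (k + m) x ≤ b * survival Q T k x := by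
  induction k generalizing x with
  | zero =>
    by_cases hT : x ∈ T
    · simp [survival_of_mem hT]
    · simpa [survival_zero hT] using hb x hx
  | succ k ih =>
    by_cases hT : x ∈ T
    · simp [survival_of_mem hT]
    · rw [add_right_comm, survival_succ hT, survival_succ hT, Finset.mul_sum]
      refine Finset.sum_le_sum fun y _ => ?_
      by_cases h0 : Q x y = 0
      · simp [h0]
      · rw [mul_left_comm]
        exact mul_le_mul_of_nonneg_left (ih (hI x hx y h0)) (hQ x y)

/-- An antitone sequence bounded by the geometric sequence `ρ ^ j` along the multiples of `K` has
bounded partial sums. -/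
theorem sum_range_le_of_le_pow {a : ℕ → ℝ} (ha : Antitone a) {K : ℕ} (hK : 0 < K) {ρ : ℝ}
    (hρ0 : 0 ≤ ρ) (hρ1 : ρ < 1) (h : ∀ j, a (j * K) ≤ ρ ^ j) (h0 : ∀ k, 0 ≤ a k) (N : ℕ) :
    ∑ k ∈ Finset.range N, a k ≤ K * (1 - ρ)⁻¹ := by
  have key : ∀ M : ℕ, ∑ k ∈ Finset.range (M * K), a k ≤ K * ∑ j ∈ Finset.range M, ρ ^ j := by
    intro M
    induction M with
    | zero => simp
    | succ M ih =>
      rw [add_mul, one_mul, Finset.sum_range_add, Finset.sum_range_succ (fun j => ρ ^ j), mul_add]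
      refine add_le_add ih ?_
      calc ∑ x ∈ Finset.range K, a (M * K + x) ≤ ∑ _x ∈ Finset.range K, ρ ^ M :=
            Finset.sum_le_sum fun x _ => (ha (Nat.le_add_right _ _)).trans (h M)
        _ = K * ρ ^ M := by simp
  calc ∑ k ∈ Finset.range N, a k ≤ ∑ k ∈ Finset.range (N * K), a k :=
        Finset.sum_le_sum_of_subset_of_nonneg
          (Finset.range_mono (Nat.le_mul_of_pos_right N hK)) fun k _ _ => h0 k
    _ ≤ K * ∑ j ∈ Finset.range N, ρ ^ j := key N
    _ ≤ K * (1 - ρ)⁻¹ := by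
        refine mul_le_mul_of_nonneg_left ?_ (Nat.cast_nonneg K)
        rw [← tsum_geometric_of_lt_one hρ0 hρ1]
        exact (summable_geometric_of_lt_one hρ0 hρ1).sum_le_tsum _ fun j _ => pow_nonneg hρ0 j

/-- If the target can be reached from every point of an invariant set, then the expected hitting
times are uniformly bounded there. -/
theorem exists_sum_survival_le (hQ : ∀ x y, 0 ≤ Q x y) (hsum : ∀ x, ∑ y, Q x y = 1) {I : Set W}
    (hI : ∀ x ∈ I, ∀ y, Q x y ≠ 0 → y ∈ I) (h : ∀ x ∈ I, ∃ k, survival Q T k x < 1) :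
    ∃ B : ℝ, ∀ x ∈ I, ∀ N, ∑ k ∈ Finset.range N, survival Q T k x ≤ B := by
  rcases I.eq_empty_or_nonempty with rfl | hne
  · exact ⟨0, by simp⟩
  choose! τ hτ using h
  -- One horizon that serves all starting points; the `+ 1` makes it positive, so that blocks of
  -- length `K` exhaust the time axis.
  set K := Finset.univ.sup τ + 1 with hK
  have hlt : ∀ x ∈ I, survival Q T K x < 1 := fun x hx =>
    (survival_antitone hQ hsum x
      ((Finset.le_sup (Finset.mem_univ x)).trans (Nat.le_succ _))).trans_lt (hτ x hx)
  -- The worst starting point of the finite set `I` supplies a ratio that is strictly below `1`.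
  obtain ⟨z, hz, hmax⟩ := I.toFinite.exists_maximalFor (survival Q T K) I hne
  have hρ : ∀ x ∈ I, survival Q T K x ≤ survival Q T K z := fun x hx =>
    (le_total _ _).elim id fun hle => hmax hx hle
  refine ⟨K * (1 - survival Q T K z)⁻¹, fun x hx N => ?_⟩
  refine sum_range_le_of_le_pow (survival_antitone hQ hsum x) (Nat.succ_pos _)
    (survival_nonneg hQ K z) (hlt z hz) (fun j => ?_) (fun k => survival_nonneg hQ k x) N
  induction j with
  | zero => simpa using survival_le_one hQ hsum 0 x
  | succ j ih =>
    rw [add_mul, one_mul, pow_succ']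
    exact (survival_add_le hQ hI hρ (j * K) hx).trans
      (mul_le_mul_of_nonneg_left ih (survival_nonneg hQ K z))

/-- A path of positive weight into `T` removes mass: at its first step the average in
`survival_succ` has a strictly smaller term. -/
theorem survival_lt_one [DecidableEq W] (hQ : ∀ x y, 0 ≤ Q x y) (hsum : ∀ x, ∑ y, Q x y = 1)
    {k : ℕ} {x y : W} (hy : y ∈ T) (h : 0 < (Q ^ k) x y) : survival Q T k x < 1 := by
  induction k generalizing x with
  | zero =>
    have hxy : x = y := by
      by_contra hne
      simp [hne] at h
    simp [survival, hxy, hy]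
  | succ k ih =>
    by_cases hx : x ∈ T
    · simp [survival_of_mem hx]
    rw [pow_succ', Matrix.mul_apply] at h
    obtain ⟨z, -, hz⟩ := Finset.exists_lt_of_sum_lt (s := Finset.univ) (f := fun _ => (0 : ℝ))
      (by simpa using h)
    have hz1 : 0 < Q x z := lt_of_le_of_ne (hQ x z) fun h0 => by simp [← h0] at hz
    have hz2 : 0 < (Q ^ k) z y := pos_of_mul_pos_right hz hz1.le
    rw [survival_succ hx, ← hsum x]
    exact Finset.sum_lt_sum
      (fun w _ => mul_le_of_le_one_right (hQ x w) (survival_le_one hQ hsum k w))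
      ⟨z, Finset.mem_univ z, mul_lt_of_lt_one_right hz1 (ih hz2)⟩

end Survival

/-! ### Closed components, aperiodicity and finiteness of the expected times -/

section Reachability

variable {V : Type*}

/-- The union of the closed strongly connected components of the graph of `P`. -/
def recurrentSet (P : Matrix V V ℝ) : Set V :=
  {j | ∃ S, IsClosedComponent (matrixGraph P) S ∧ j ∈ S}

/-- In a finite graph every node can be reached from a closed strongly connected component. -/
theorem exists_isClosedComponent_hasPath [Finite V] (G : Digraph V) (i : V) :
    ∃ S, IsClosedComponent G S ∧ ∃ j ∈ S, HasPath G j i := by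
  -- Among the ancestors of `i`, take one with the fewest ancestors. A node `l` with an edge into
  -- its component has no more ancestors than `j`, hence by minimality the same ones. So `j` is an
  -- ancestor of `l`, and `l` lies in the component.
  obtain ⟨j, hj, hmin⟩ := {j | HasPath G j i}.toFinite.exists_minimalFor
    (fun j => {w | HasPath G w j}.ncard) _ ⟨i, Relation.ReflTransGen.refl⟩
  refine ⟨{k | HasPath G j k ∧ HasPath G k j}, ⟨⟨j, rfl⟩, ?_⟩, j,
    ⟨Relation.ReflTransGen.refl, Relation.ReflTransGen.refl⟩, hj⟩
  rintro l hl r ⟨-, hr⟩ hadj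
  have hlj : HasPath G l j := Relation.ReflTransGen.head hadj hr
  have hsub : {w | HasPath G w l} ⊆ {w | HasPath G w j} := fun w hw =>
    Relation.ReflTransGen.trans hw hlj
  have heq : {w | HasPath G w l} = {w | HasPath G w j} :=
    Set.eq_of_subset_of_ncard_le hsub
      (hmin (Relation.ReflTransGen.trans hlj hj) (Set.ncard_le_ncard hsub)) (Set.toFinite _)
  have hjl : j ∈ {w | HasPath G w l} := heq ▸ (Relation.ReflTransGen.refl : HasPath G j j)
  exact hl ⟨hjl, hlj⟩

/-- Walks traverse edges backwards, so a component that no edge enters is one that no walk leaves.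
-/
theorem IsClosedComponent.mem_of_ne_zero {P : Matrix V V ℝ} (hP : ∀ x y, 0 ≤ P x y) {S : Set V}
    (hS : IsClosedComponent (matrixGraph P) S) {u v : V} (hu : u ∈ S) (h : P u v ≠ 0) : v ∈ S := by
  by_contra hv
  exact hS.2 v hv u hu (lt_of_le_of_ne (hP u v) h.symm)

theorem IsStrongComponent.hasPath {G : Digraph V} {S : Set V} (hS : IsStrongComponent G S)
    {u v : V} (hu : u ∈ S) (hv : v ∈ S) : HasPath G u v := by
  obtain ⟨i, rfl⟩ := hS
  exact Relation.ReflTransGen.trans hu.2 hv.1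

theorem kronecker_self_nonneg {P : Matrix V V ℝ} (hP : ∀ x y, 0 ≤ P x y) (x y : V × V) :
    0 ≤ (P ⊗ₖ P) x y :=
  mul_nonneg (hP _ _) (hP _ _)

theorem sum_kronecker_self [Fintype V] {P : Matrix V V ℝ} (hsum : ∀ x, ∑ y, P x y = 1)
    (x : V × V) : ∑ y, (P ⊗ₖ P) x y = 1 := by
  rw [Fintype.sum_prod_type]
  change ∑ a, ∑ b, P x.1 a * P x.2 b = 1
  simp only [← Finset.mul_sum, hsum, mul_one]

variable [Fintype V] [DecidableEq V] {P : Matrix V V ℝ}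

theorem pow_nonneg_apply (hP : ∀ x y, 0 ≤ P x y) (k : ℕ) (x y : V) : 0 ≤ (P ^ k) x y := by
  induction k generalizing x with
  | zero => rw [pow_zero, Matrix.one_apply]; split_ifs <;> norm_num
  | succ k ih =>
    rw [pow_succ', Matrix.mul_apply]
    exact Finset.sum_nonneg fun z _ => mul_nonneg (hP x z) (ih z)

theorem pow_add_pos (hP : ∀ x y, 0 ≤ P x y) {k l : ℕ} {x y z : V} (h1 : 0 < (P ^ k) x y)
    (h2 : 0 < (P ^ l) y z) : 0 < (P ^ (k + l)) x z := by
  rw [pow_add, Matrix.mul_apply]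
  exact Finset.sum_pos'
    (fun w _ => mul_nonneg (pow_nonneg_apply hP k x w) (pow_nonneg_apply hP l w z))
    ⟨y, Finset.mem_univ y, mul_pos h1 h2⟩

theorem exists_pow_pos_of_hasPath (hP : ∀ x y, 0 ≤ P x y) {i j : V}
    (h : HasPath (matrixGraph P) i j) : ∃ k, 0 < (P ^ k) j i := by
  induction h with
  | refl => exact ⟨0, by simp⟩
  | tail _ hadj ih =>
    obtain ⟨k, hk⟩ := ih
    exact ⟨1 + k, pow_add_pos hP (by rw [pow_one]; exact hadj) hk⟩

theorem IsClosedComponent.mem_of_pow_ne_zero (hP : ∀ x y, 0 ≤ P x y) {S : Set V}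
    (hS : IsClosedComponent (matrixGraph P) S) {k : ℕ} {u v : V} (hu : u ∈ S)
    (h : (P ^ k) u v ≠ 0) : v ∈ S := by
  induction k generalizing u with
  | zero =>
    rw [pow_zero, Matrix.one_apply] at h
    by_cases huv : u = v
    · exact huv ▸ hu
    · simp [huv] at h
  | succ k ih =>
    rw [pow_succ', Matrix.mul_apply] at h
    obtain ⟨z, -, hz⟩ := Finset.exists_ne_zero_of_sum_ne_zero h
    exact ih (hS.mem_of_ne_zero hP hu (left_ne_zero_of_mul hz)) (right_ne_zero_of_mul hz)

theorem pow_pos_of_walk (hP : ∀ x y, 0 ≤ P x y) {l : ℕ} (p : Fin (l + 1) → V)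
    (hp : ∀ t : Fin l, (matrixGraph P).Adj (p t.castSucc) (p t.succ)) :
    0 < (P ^ l) (p (Fin.last l)) (p 0) := by
  induction l with
  | zero => simp
  | succ l ih =>
    have h := pow_add_pos hP (k := 1) (l := l) (x := p (Fin.last (l + 1)))
      (y := p (Fin.last l).castSucc) (z := p 0) ?_ ?_
    · rwa [add_comm 1 l] at h
    · rw [pow_one]
      exact hp (Fin.last l)
    · exact ih (fun t => p t.castSucc) fun t => hp t.castSucc

/-- All large numbers are return times of a node of an aperiodic strongly connected component. -/
theorem exists_forall_ge_pow_pos (hP : ∀ x y, 0 ≤ P x y) {S : Set V}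
    (hS : IsStrongComponent (matrixGraph P) S) (hap : IsAperiodic (matrixGraph P) S) {u : V}
    (hu : u ∈ S) : ∃ N, ∀ k ≥ N, 0 < (P ^ k) u u := by
  -- The return times to `u` form a submonoid of `ℕ`, which contains all large multiples of its gcd.
  let R : AddSubmonoid ℕ :=
    { carrier := {k | 0 < (P ^ k) u u}
      zero_mem' := by simp
      add_mem' := fun ha hb => pow_add_pos hP ha hb }
  have hR : ∀ k, k ∈ R ↔ 0 < (P ^ k) u u := fun k => Iff.rfl
  have hgcd : Nat.setGcd (R : Set ℕ) = 1 := by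
    refine hap _ ?_
    rintro l ⟨p, hpS, hadj, hcl⟩
    have hl := pow_pos_of_walk hP p hadj
    rw [← hcl] at hl
    obtain ⟨a, ha⟩ := exists_pow_pos_of_hasPath hP (hS.hasPath (hpS 0) hu)
    obtain ⟨c, hc⟩ := exists_pow_pos_of_hasPath hP (hS.hasPath hu (hpS 0))
    -- A cycle need not pass through `u`. The detour to it and back is a return, with or without
    -- running the cycle, so the gcd divides the difference `l`.
    have h1 : Nat.setGcd (R : Set ℕ) ∣ a + c :=
      Nat.setGcd_dvd_of_mem ((hR _).2 (pow_add_pos hP ha hc))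
    have h2 : Nat.setGcd (R : Set ℕ) ∣ a + (l + c) :=
      Nat.setGcd_dvd_of_mem ((hR _).2 (pow_add_pos hP ha (pow_add_pos hP hl hc)))
    rw [add_left_comm] at h2
    exact (Nat.dvd_add_left h1).1 h2
  obtain ⟨N, hN⟩ := Nat.exists_mem_closure_of_ge (R : Set ℕ)
  refine ⟨N, fun k hk => (hR k).1 ?_⟩
  have := hN k hk (by rw [hgcd]; exact one_dvd k)
  rwa [AddSubmonoid.closure_eq] at this

theorem kronecker_self_pow (P : Matrix V V ℝ) (k : ℕ) : (P ⊗ₖ P) ^ k = (P ^ k) ⊗ₖ (P ^ k) := by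
  induction k with
  | zero => simp
  | succ k ih => rw [pow_succ, ih, ← Matrix.mul_kronecker_mul, ← pow_succ]

theorem exists_sum_survival_recurrentSet_le (hP : ∀ x y, 0 ≤ P x y)
    (hsum : ∀ x, ∑ y, P x y = 1) :
    ∃ B : ℝ, ∀ i N, ∑ k ∈ Finset.range N, survival P (recurrentSet P) k i ≤ B := by
  obtain ⟨B, hB⟩ := exists_sum_survival_le (T := recurrentSet P) (I := Set.univ) hP hsum
    (fun _ _ _ _ => trivial) fun i _ => by
      obtain ⟨S, hS, j, hj, hji⟩ := exists_isClosedComponent_hasPath (matrixGraph P) i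
      obtain ⟨k, hk⟩ := exists_pow_pos_of_hasPath hP hji
      exact ⟨k, survival_lt_one hP hsum ⟨S, hS, hj⟩ hk⟩
  exact ⟨B, fun i => hB i trivial⟩

/-- Two walks in an aperiodic closed component can meet at `u` itself: the walk from `v` gets there
in `b` steps and stays for a loop of length `N`, while the walk from `u` has a loop of length `b +
N` once `N` is large. -/
theorem exists_sum_survival_diagonal_le (hP : ∀ x y, 0 ≤ P x y) (hsum : ∀ x, ∑ y, P x y = 1)
    (hap : ∀ S, IsClosedComponent (matrixGraph P) S → IsAperiodic (matrixGraph P) S) :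
    ∃ B : ℝ, ∀ S, IsClosedComponent (matrixGraph P) S → ∀ u ∈ S, ∀ v ∈ S, ∀ N,
      ∑ k ∈ Finset.range N, survival (P ⊗ₖ P) (Set.diagonal V) k (u, v) ≤ B := by
  have hI : ∀ x ∈ {x : V × V | ∃ S, IsClosedComponent (matrixGraph P) S ∧ x.1 ∈ S ∧ x.2 ∈ S},
      ∀ y, (P ⊗ₖ P) x y ≠ 0 →
        y ∈ {x : V × V | ∃ S, IsClosedComponent (matrixGraph P) S ∧ x.1 ∈ S ∧ x.2 ∈ S} := by
    rintro x ⟨S, hS, h1, h2⟩ y hxy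
    exact ⟨S, hS, hS.mem_of_ne_zero hP h1 (left_ne_zero_of_mul hxy),
      hS.mem_of_ne_zero hP h2 (right_ne_zero_of_mul hxy)⟩
  obtain ⟨B, hB⟩ := exists_sum_survival_le (T := Set.diagonal V)
    (kronecker_self_nonneg hP) (sum_kronecker_self hsum) hI fun ⟨u, v⟩ ⟨S, hS, hu, hv⟩ => by
      obtain ⟨N, hN⟩ := exists_forall_ge_pow_pos hP hS.1 (hap S hS) hu
      obtain ⟨b, hb⟩ := exists_pow_pos_of_hasPath hP (hS.1.hasPath hu hv)
      refine ⟨b + N, survival_lt_one (kronecker_self_nonneg hP) (sum_kronecker_self hsum)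
        (y := (u, u)) rfl ?_⟩
      rw [kronecker_self_pow, Matrix.kronecker_apply]
      exact mul_pos (hN _ (Nat.le_add_left N b)) (pow_add_pos hP hb (hN N le_rfl))
  exact ⟨B, fun S hS u hu v hv => hB (u, v) ⟨S, hS, hu, hv⟩⟩

end Reachability

/-! ### The trajectory law and expected times as sums of survival probabilities -/

section WalkLaw

variable {V : Type*}

/-- The trajectory that starts at `i` and continues with `X`. -/
def prepend (i : V) (X : ℕ → V) : ℕ → V
  | 0 => i
  | k + 1 => X k

theorem measurable_prepend [MeasurableSpace V] (i : V) : Measurable (prepend i) := by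
  refine measurable_pi_lambda _ fun k => ?_
  cases k with
  | zero => exact measurable_const
  | succ k => exact measurable_pi_apply k

theorem forall_le_prepend_iff {i : V} {X : ℕ → V} {k : ℕ} {p : ℕ → V → Prop} :
    (∀ l ≤ k + 1, p l (prepend i X l)) ↔ p 0 i ∧ ∀ l ≤ k, p (l + 1) (X l) := by
  refine ⟨fun h => ⟨h 0 (Nat.zero_le _), fun l hl => h (l + 1) (Nat.succ_le_succ hl)⟩, ?_⟩
  rintro ⟨h0, h⟩ (_ | l) hl
  · exact h0
  · exact h l (Nat.le_of_succ_le_succ hl)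

/-- Finite measures on trajectories that agree on the cylinders over points are equal. -/
theorem measure_ext_of_cylinder [Countable V] [MeasurableSpace V]
    [MeasurableSingletonClass V] {μ ν : Measure (ℕ → V)} [IsFiniteMeasure μ] [IsFiniteMeasure ν]
    (h : ∀ (k : ℕ) (p : ℕ → V), μ {X | ∀ l ≤ k, X l = p l} = ν {X | ∀ l ≤ k, X l = p l}) :
    μ = ν := by
  have hfam : IsProjectiveMeasureFamily (α := fun _ : ℕ => V)
      fun I : Finset ℕ => ν.map I.restrict := by
    intro I J hJI
    rw [Measure.map_map (by fun_prop) (by fun_prop)]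
    rfl
  have hν : IsProjectiveLimit (α := fun _ : ℕ => V) ν fun I : Finset ℕ => ν.map I.restrict :=
    fun I => rfl
  have hfin : ∀ I : Finset ℕ, IsFiniteMeasure (ν.map (I.restrict (π := fun _ => V))) :=
    fun I => inferInstance
  refine IsProjectiveLimit.unique ((isProjectiveLimit_nat_iff hfam μ).2 fun k => ?_) hν
  change μ.map (Preorder.frestrictLe k) = ν.map (Preorder.frestrictLe k)
  refine Measure.ext_of_singleton fun y => ?_
  by_cases hV : Nonempty V
  · obtain ⟨v⟩ := hV
    -- The value `v` after time `k` is arbitrary, because the cylinder only constrains the times up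
    -- to `k`.
    let p : ℕ → V := fun l => if hl : l ≤ k then y ⟨l, Finset.mem_Iic.2 hl⟩ else v
    have hset : Preorder.frestrictLe (π := fun _ => V) k ⁻¹' {y} = {X : ℕ → V | ∀ l ≤ k, X l = p l} := by
      ext X
      simp only [Set.mem_ofPred_eq, Set.mem_preimage, Set.mem_singleton_iff,
        funext_iff, Subtype.forall, Finset.mem_Iic, Preorder.frestrictLe_apply, p]
      refine forall₂_congr fun l hl => ?_
      rw [dif_pos hl]
    rw [Measure.map_apply (by fun_prop) (measurableSet_singleton y),
      Measure.map_apply (by fun_prop) (measurableSet_singleton y), hset, h]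
  · exact (hV ⟨y ⟨0, by simp⟩⟩).elim

theorem measurableSet_avoid [Finite V] [MeasurableSpace V]
    [MeasurableSingletonClass V] (T : Set V) (k : ℕ) :
    MeasurableSet {X : ℕ → V | ∀ l ≤ k, X l ∉ T} := by
  simp only [Set.ofPred_forall]
  exact .iInter fun l => .iInter fun _ => (measurable_pi_apply (X := fun _ => V) l)
    T.toFinite.measurableSet.compl

theorem measurableSet_not_met [Countable V] [MeasurableSpace V]
    [MeasurableSingletonClass V] (k : ℕ) :
    MeasurableSet {ω : (ℕ → V) × (ℕ → V) | ∀ l ≤ k, ω.1 l ≠ ω.2 l} := by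
  simp only [Set.ofPred_forall]
  refine .iInter fun l => .iInter fun _ => (measurableSet_eq_fun ?_ ?_).compl <;> fun_prop

variable [Fintype V] [DecidableEq V] [MeasurableSpace V] [MeasurableSingletonClass V]
  {P : Matrix V V ℝ} (hP : P ∈ Matrix.rowStochastic ℝ V)

theorem stepKernel_singleton (i j : V) : stepKernel P hP i {j} = ENNReal.ofReal (P i j) := by
  change (rowPMF P hP i).toMeasure {j} = _
  rw [PMF.toMeasure_apply_singleton _ _ (measurableSet_singleton j)]
  rfl

theorem walkLaw_cylinder (i : V) (p : ℕ → V) (k : ℕ) :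
    walkLaw P hP i {X | ∀ l ≤ k, X l = p l} =
      (if i = p 0 then 1 else 0) *
        ∏ l ∈ Finset.range k, ENNReal.ofReal (P (p l) (p (l + 1))) := by
  induction k with
  | zero =>
    have hset : {X : ℕ → V | ∀ l ≤ 0, X l = p l} =
        Preorder.frestrictLe 0 ⁻¹' ((fun y : Π _ : Finset.Iic 0, V =>
          y ⟨0, Finset.mem_Iic.2 le_rfl⟩) ⁻¹' {p 0}) := by
      ext X; simp
    have hm : MeasurableSet ((fun y : Π _ : Finset.Iic 0, V =>
          y ⟨0, Finset.mem_Iic.2 le_rfl⟩) ⁻¹' {p 0}) :=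
      measurable_pi_apply _ (measurableSet_singleton _)
    rw [hset, ← Measure.map_apply (by fun_prop) hm, walkLaw, Kernel.trajMeasure,
      Measure.map_comp _ _ (by fun_prop), Kernel.traj_map_frestrictLe, Kernel.partialTraj_self,
      Measure.id_comp, Measure.map_apply (by fun_prop) hm, Measure.dirac_apply' _
        ((MeasurableEquiv.measurable _) hm)]
    by_cases h : i = p 0 <;> simp [h, Set.indicator]
  | succ k ih =>
    have hset : {X : ℕ → V | ∀ l ≤ k + 1, X l = p l} =
        (fun X => (Preorder.frestrictLe (π := fun _ => V) k X, X (k + 1))) ⁻¹'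
          ({Preorder.frestrictLe k p} ×ˢ {p (k + 1)}) := by
      ext X
      simp only [Set.mem_ofPred_eq, Set.mem_preimage, Set.mem_prod, Set.mem_singleton_iff,
        Nat.le_succ_iff, or_imp, forall_and, forall_eq, funext_iff, Subtype.forall,
        Finset.mem_Iic, Preorder.frestrictLe_apply]
    have hset' : {X : ℕ → V | ∀ l ≤ k, X l = p l} =
        Preorder.frestrictLe (π := fun _ => V) k ⁻¹' {Preorder.frestrictLe k p} := by
      ext X
      simp only [Set.mem_ofPred_eq, Set.mem_preimage, Set.mem_singleton_iff,
        funext_iff, Subtype.forall, Finset.mem_Iic, Preorder.frestrictLe_apply]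
    rw [hset, ← Measure.map_apply (by fun_prop)
      ((measurableSet_singleton _).prod (measurableSet_singleton _)), walkLaw,
      ← Kernel.map_frestrictLe_trajMeasure_compProd_eq_map_trajMeasure,
      Measure.compProd_apply_prod (measurableSet_singleton _) (measurableSet_singleton _),
      Measure.restrict_singleton, lintegral_smul_measure, lintegral_dirac,
      Measure.map_apply (by fun_prop) (measurableSet_singleton _), ← hset', ← walkLaw, ih,
      Finset.prod_range_succ, ← mul_assoc, smul_eq_mul]
    congr 1
    exact stepKernel_singleton hP _ _

/-- Conditioning on the first step of the random walk. -/
theorem walkLaw_first_step (i : V) :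
    walkLaw P hP i = ∑ j, ENNReal.ofReal (P i j) • (walkLaw P hP j).map (prepend i) := by
  have hfin : IsFiniteMeasure
      (∑ j, ENNReal.ofReal (P i j) • (walkLaw P hP j).map (prepend i)) := by
    refine ⟨?_⟩
    rw [Measure.finsetSum_apply]
    refine ENNReal.sum_lt_top.2 fun j _ => ?_
    rw [Measure.smul_apply, smul_eq_mul]
    exact ENNReal.mul_lt_top ENNReal.ofReal_lt_top
      (by rw [Measure.map_apply (measurable_prepend i) .univ]; exact measure_lt_top _ _)
  have hm : ∀ (k : ℕ) (p : ℕ → V), MeasurableSet {X : ℕ → V | ∀ l ≤ k, X l = p l} := by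
    intro k p
    simp only [Set.ofPred_forall]
    exact .iInter fun l => .iInter fun _ => measurable_pi_apply l (measurableSet_singleton _)
  have hstep : ∀ (k : ℕ) (p : ℕ → V),
      (∑ j, ENNReal.ofReal (P i j) • (walkLaw P hP j).map (prepend i))
        {X | ∀ l ≤ k + 1, X l = p l} = walkLaw P hP i {X | ∀ l ≤ k + 1, X l = p l} := by
    intro k p
    simp only [Measure.finsetSum_apply, Measure.smul_apply, smul_eq_mul,
      Measure.map_apply (measurable_prepend i) (hm _ _), Set.preimage_ofPred_eq]
    simp only [forall_le_prepend_iff (p := fun l v => v = p l)]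
    rw [walkLaw_cylinder]
    by_cases hi : i = p 0
    · simp only [hi, true_and, if_true, one_mul]
      simp_rw [walkLaw_cylinder hP _ (fun l => p (l + 1))]
      simp [Finset.prod_range_succ', mul_comm]
    · simp [hi]
  refine measure_ext_of_cylinder fun k p => ?_
  cases k with
  | succ k => exact (hstep k p).symm
  | zero =>
    -- A cylinder at time `0` sees only the prepended node, so the weights of the first step have to
    -- add up to `1`.
    have hsum : ∑ j, ENNReal.ofReal (P i j) = 1 := by
      rw [← ENNReal.ofReal_sum_of_nonneg (fun j _ => Matrix.nonneg_of_mem_rowStochastic hP),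
        Matrix.sum_row_of_mem_rowStochastic hP, ENNReal.ofReal_one]
    rw [walkLaw_cylinder]
    simp only [Measure.finsetSum_apply, Measure.smul_apply, smul_eq_mul,
      Measure.map_apply (measurable_prepend i) (hm _ _), Set.preimage_ofPred_eq]
    by_cases hi : i = p 0
    · simp [← hi, prepend, hsum]
    · simp [hi, prepend]

/-- Conditioning on the first step gives the avoidance probabilities the same recursion as
`survival`. -/
theorem walkLaw_avoid (T : Set V) (k : ℕ) (i : V) :
    walkLaw P hP i {X | ∀ l ≤ k, X l ∉ T} = ENNReal.ofReal (survival P T k i) := by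
  have hfirst : ∀ k i, walkLaw P hP i {X | ∀ l ≤ k, X l ∉ T} = ∑ j, ENNReal.ofReal (P i j) *
      walkLaw P hP j {X | ∀ l ≤ k, prepend i X l ∉ T} := by
    intro k i
    rw [walkLaw_first_step hP i]
    simp only [Measure.finsetSum_apply, Measure.smul_apply, smul_eq_mul,
      Measure.map_apply (measurable_prepend i) (measurableSet_avoid T k), Set.preimage_ofPred_eq]
  have hnn : ∀ x y, 0 ≤ P x y := fun x y => Matrix.nonneg_of_mem_rowStochastic hP
  induction k generalizing i with
  | zero =>
    rw [hfirst]
    by_cases hi : i ∈ T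
    · simp [hi, prepend, survival]
    · simp only [nonpos_iff_eq_zero, forall_eq, prepend, hi, not_false_eq_true, Set.ofPred_true,
        measure_univ, mul_one, survival_zero hi]
      rw [← ENNReal.ofReal_sum_of_nonneg (fun j _ => hnn i j),
        Matrix.sum_row_of_mem_rowStochastic hP]
  | succ k ih =>
    rw [hfirst]
    simp only [forall_le_prepend_iff (p := fun _ v => v ∉ T)]
    by_cases hi : i ∈ T
    · simp [hi, survival]
    · simp only [hi, not_false_eq_true, true_and, ih, survival_succ hi]
      rw [ENNReal.ofReal_sum_of_nonneg fun j _ => mul_nonneg (hnn i j) (survival_nonneg hnn k j)]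
      simp only [ENNReal.ofReal_mul (hnn i _)]

/-- Conditioning on the first steps of two independent random walks. -/
theorem walkLaw_prod_first_step (u v : V) {E : Set ((ℕ → V) × (ℕ → V))} (hE : MeasurableSet E) :
    ((walkLaw P hP u).prod (walkLaw P hP v)) E = ∑ a, ∑ b,
      ENNReal.ofReal (P u a) * ENNReal.ofReal (P v b) *
        ((walkLaw P hP a).prod (walkLaw P hP b))
          (Prod.map (prepend u) (prepend v) ⁻¹' E) := by
  have hpre : ∀ X : ℕ → V, MeasurableSet (Prod.mk X ⁻¹' E) := fun X => measurable_prodMk_left hE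
  have hE' : MeasurableSet (Prod.map (prepend u) (prepend v) ⁻¹' E) :=
    ((measurable_prepend u).prodMap (measurable_prepend v)) hE
  have hmeas : ∀ b, Measurable fun X : ℕ → V =>
      walkLaw P hP b (prepend v ⁻¹' (Prod.mk X ⁻¹' E)) := by
    intro b
    exact measurable_measure_prodMk_left
      (((measurable_id (α := ℕ → V)).prodMap (measurable_prepend v)) hE)
  have hmeas' : ∀ b, Measurable fun X : ℕ → V =>
      walkLaw P hP b (prepend v ⁻¹' (Prod.mk (prepend u X) ⁻¹' E)) :=
    fun b => (hmeas b).comp (measurable_prepend u)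
  have hv : ∀ X : ℕ → V, walkLaw P hP v (Prod.mk X ⁻¹' E) =
      ∑ b, ENNReal.ofReal (P v b) * walkLaw P hP b (prepend v ⁻¹' (Prod.mk X ⁻¹' E)) := by
    intro X
    conv_lhs => rw [walkLaw_first_step hP v]
    simp only [Measure.finsetSum_apply, Measure.smul_apply, smul_eq_mul,
      Measure.map_apply (measurable_prepend v) (hpre X)]
  rw [Measure.prod_apply hE]
  simp only [hv]
  rw [walkLaw_first_step hP u, lintegral_finsetSum_measure]
  refine Finset.sum_congr rfl fun a _ => ?_
  rw [lintegral_smul_measure, smul_eq_mul, lintegral_map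
    (Finset.measurable_fun_sum _ fun b _ => (hmeas b).const_mul _) (measurable_prepend u),
    lintegral_finsetSum _ fun b _ => (hmeas' b).const_mul _, Finset.mul_sum]
  refine Finset.sum_congr rfl fun b _ => ?_
  rw [Measure.prod_apply hE', mul_assoc]
  congr 1
  exact lintegral_const_mul _ (hmeas' b)

/-- Two independent walks form one walk with matrix `P ⊗ₖ P`, and not having met means avoiding the
diagonal. -/
theorem walkLaw_prod_not_met (k : ℕ) (u v : V) :
    ((walkLaw P hP u).prod (walkLaw P hP v)) {ω | ∀ l ≤ k, ω.1 l ≠ ω.2 l} =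
      ENNReal.ofReal (survival (P ⊗ₖ P) (Set.diagonal V) k (u, v)) := by
  have hnn : ∀ x y, 0 ≤ P x y := fun x y => Matrix.nonneg_of_mem_rowStochastic hP
  have hnn' : ∀ x y, 0 ≤ (P ⊗ₖ P) x y := fun x y => mul_nonneg (hnn _ _) (hnn _ _)
  have hrow : ∀ i, ∑ j, ENNReal.ofReal (P i j) = 1 := fun i => by
    rw [← ENNReal.ofReal_sum_of_nonneg (fun j _ => hnn i j),
      Matrix.sum_row_of_mem_rowStochastic hP, ENNReal.ofReal_one]
  induction k generalizing u v with
  | zero =>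
    rw [walkLaw_prod_first_step hP u v (measurableSet_not_met 0)]
    by_cases huv : u = v
    · have hmem : (u, v) ∈ Set.diagonal V := huv
      simp [huv, prepend, survival_of_mem]
    · have hmem : (u, v) ∉ Set.diagonal V := huv
      simp [huv, prepend, survival_zero hmem, ← Finset.mul_sum, hrow]
  | succ k ih =>
    rw [walkLaw_prod_first_step hP u v (measurableSet_not_met (k + 1))]
    have hset : Prod.map (prepend u) (prepend v) ⁻¹' {ω | ∀ l ≤ k + 1, ω.1 l ≠ ω.2 l} =
        {ω | u ≠ v ∧ ∀ l ≤ k, ω.1 l ≠ ω.2 l} := by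
      ext ω
      refine ⟨fun h => ⟨h 0 (Nat.zero_le _), fun l hl => h (l + 1) (Nat.succ_le_succ hl)⟩, ?_⟩
      rintro ⟨h0, h⟩ (_ | l) hl
      · exact h0
      · exact h l (Nat.le_of_succ_le_succ hl)
    rw [hset]
    by_cases huv : u = v
    · have hmem : (u, v) ∈ Set.diagonal V := huv
      simp [huv, survival_of_mem]
    · have hmem : (u, v) ∉ Set.diagonal V := huv
      simp only [ne_eq, huv, not_false_eq_true, true_and]
      simp only [ne_eq] at ih
      simp only [ih, survival_succ hmem]
      rw [ENNReal.ofReal_sum_of_nonneg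
        fun j _ => mul_nonneg (hnn' _ j) (survival_nonneg hnn' k j), Fintype.sum_prod_type]
      refine Finset.sum_congr rfl fun a _ => Finset.sum_congr rfl fun b _ => ?_
      rw [ENNReal.ofReal_mul (hnn' _ _), Matrix.kronecker_apply, ENNReal.ofReal_mul (hnn _ _)]

/-- A first hitting time is the number of initial times without a hit. -/
theorem iInf_cast_eq_tsum (p : ℕ → Prop) :
    ⨅ (k : ℕ) (_ : p k), (k : ℝ≥0∞) = ∑' k : ℕ, {k : ℕ | ∀ l ≤ k, ¬ p l}.indicator 1 k := by
  classical
  by_cases h : ∃ k, p k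
  · have hset : {k : ℕ | ∀ l ≤ k, ¬ p l} = Finset.range (Nat.find h) := by
      ext k
      simp [Nat.lt_find_iff]
    rw [hset, tsum_eq_sum (s := Finset.range (Nat.find h)) (by simp),
      Finset.sum_congr rfl (g := fun _ => (1 : ℝ≥0∞)) (fun k hk => Set.indicator_of_mem (Finset.mem_coe.2 hk) _)]
    simp only [Finset.sum_const, Finset.card_range, nsmul_eq_mul, mul_one]
    refine le_antisymm (iInf₂_le _ (Nat.find_spec h)) (le_iInf₂ fun k hk => ?_)
    exact_mod_cast Nat.find_min' h hk
  · push Not at h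
    simp [h]

theorem lintegral_absorptionTime (i : V) :
    ∫⁻ X, absorptionTime (matrixGraph P) X ∂(walkLaw P hP i) = ∑' k, ENNReal.ofReal
      (survival P {j | ∃ S, IsClosedComponent (matrixGraph P) S ∧ j ∈ S} k i) := by
  classical
  set T : Set V := {j | ∃ S, IsClosedComponent (matrixGraph P) S ∧ j ∈ S} with hT
  have heq : ∀ X : ℕ → V, absorptionTime (matrixGraph P) X =
      ∑' k : ℕ, {X : ℕ → V | ∀ l ≤ k, X l ∉ T}.indicator 1 X := by
    intro X
    rw [absorptionTime, iInf_cast_eq_tsum]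
    rfl
  simp only [heq]
  rw [lintegral_tsum fun k => (measurable_one.indicator (measurableSet_avoid T k)).aemeasurable]
  exact tsum_congr fun k => by
    rw [lintegral_indicator_one (measurableSet_avoid T k), walkLaw_avoid]

theorem lintegral_couplingTime (u v : V) :
    ∫⁻ ω, couplingTime ω.1 ω.2 ∂((walkLaw P hP u).prod (walkLaw P hP v)) = ∑' k, ENNReal.ofReal
      (survival (P ⊗ₖ P) (Set.diagonal V) k (u, v)) := by
  classical
  have heq : ∀ ω : (ℕ → V) × (ℕ → V), couplingTime ω.1 ω.2 = ∑' k : ℕ,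
      {ω : (ℕ → V) × (ℕ → V) | ∀ l ≤ k, ω.1 l ≠ ω.2 l}.indicator 1 ω := by
    intro ω
    rw [couplingTime, iInf_cast_eq_tsum]
    rfl
  simp only [heq]
  rw [lintegral_tsum fun k => (measurable_one.indicator (measurableSet_not_met k)).aemeasurable]
  exact tsum_congr fun k => by
    rw [lintegral_indicator_one (measurableSet_not_met k), walkLaw_prod_not_met]

end WalkLaw

/-! ### The coupling bound and convergence -/

section Mixing

variable {V : Type*} [Fintype V] [DecidableEq V] {P : Matrix V V ℝ}

open scoped Classical in
/-- The probability that a random walk started at `i` is not yet coupled at time `k`, where, once it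
is at a recurrent node `u`, it is coupled with an independent walk whose starting point is
distributed as the position at time `n` of a random walk started at `u`. -/
noncomputable def uncoupled (P : Matrix V V ℝ) (n : ℕ) : ℕ → V → ℝ
  | 0, i => if i ∈ recurrentSet P then
      ∑ v, (P ^ n) i v * survival (P ⊗ₖ P) (Set.diagonal V) 0 (i, v) else 1
  | k + 1, i => if i ∈ recurrentSet P then
      ∑ v, (P ^ n) i v * survival (P ⊗ₖ P) (Set.diagonal V) (k + 1) (i, v)
    else ∑ j, P i j * uncoupled P n k j

theorem uncoupled_of_mem (n k : ℕ) {i : V} (hi : i ∈ recurrentSet P) : uncoupled P n k i =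
    ∑ v, (P ^ n) i v * survival (P ⊗ₖ P) (Set.diagonal V) k (i, v) := by
  cases k <;> simp [uncoupled, hi]

theorem uncoupled_zero (n : ℕ) {i : V} (hi : i ∉ recurrentSet P) : uncoupled P n 0 i = 1 := by
  simp [uncoupled, hi]

theorem uncoupled_succ (n k : ℕ) {i : V} (hi : i ∉ recurrentSet P) :
    uncoupled P n (k + 1) i = ∑ j, P i j * uncoupled P n k j := by
  simp [uncoupled, hi]

variable (hP : ∀ x y, 0 ≤ P x y)
include hP

/-- A bound on the probabilities of not being coupled, uniform over the recurrent pairs and over all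
nodes, applies again after any time `k`. -/
theorem uncoupled_add_le {n m : ℕ} {b : ℝ}
    (hf : ∀ S, IsClosedComponent (matrixGraph P) S → ∀ u ∈ S, ∀ v ∈ S,
      survival (P ⊗ₖ P) (Set.diagonal V) m (u, v) ≤ b)
    (hb : ∀ i, uncoupled P n m i ≤ b) (k : ℕ) (i : V) :
    uncoupled P n (k + m) i ≤ b * uncoupled P n k i := by
  have hrec : ∀ k i, i ∈ recurrentSet P →
      uncoupled P n (k + m) i ≤ b * uncoupled P n k i := by
    rintro k i ⟨S, hS, hiS⟩
    have hi : i ∈ recurrentSet P := ⟨S, hS, hiS⟩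
    rw [uncoupled_of_mem n _ hi, uncoupled_of_mem n _ hi, Finset.mul_sum]
    refine Finset.sum_le_sum fun v _ => ?_
    by_cases h0 : (P ^ n) i v = 0
    · simp [h0]
    rw [mul_left_comm]
    refine mul_le_mul_of_nonneg_left ?_ (pow_nonneg_apply hP n i v)
    -- The second walk also starts in `S`, since `n` steps from `i` cannot leave a closed component;
    -- the bound `hf` therefore applies to the pair.
    refine survival_add_le (kronecker_self_nonneg hP) (I := S ×ˢ S) ?_
      (fun x hx => hf S hS x.1 hx.1 x.2 hx.2) k ⟨hiS, hS.mem_of_pow_ne_zero hP hiS h0⟩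
    rintro x ⟨h1, h2⟩ y hxy
    exact ⟨hS.mem_of_ne_zero hP h1 (left_ne_zero_of_mul hxy),
      hS.mem_of_ne_zero hP h2 (right_ne_zero_of_mul hxy)⟩
  induction k generalizing i with
  | zero =>
    by_cases hi : i ∈ recurrentSet P
    · exact hrec 0 i hi
    · simpa [uncoupled_zero n hi] using hb i
  | succ k ih =>
    by_cases hi : i ∈ recurrentSet P
    · exact hrec _ i hi
    · rw [add_right_comm, uncoupled_succ n _ hi, uncoupled_succ n _ hi, Finset.mul_sum]
      refine Finset.sum_le_sum fun j _ => ?_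
      rw [mul_left_comm]
      exact mul_le_mul_of_nonneg_left (ih j) (hP i j)

variable (hsum : ∀ x, ∑ y, P x y = 1)
include hsum

theorem sum_pow_apply (n : ℕ) (i : V) : ∑ j, (P ^ n) i j = 1 :=
  Matrix.sum_row_of_mem_rowStochastic
    (pow_mem (Matrix.mem_rowStochastic_iff_sum.2 ⟨hP, hsum⟩) n) i

theorem uncoupled_le_one (n k : ℕ) (i : V) : uncoupled P n k i ≤ 1 := by
  have hrec : ∀ k, i ∈ recurrentSet P → uncoupled P n k i ≤ 1 := by
    intro k hi
    rw [uncoupled_of_mem n k hi, ← sum_pow_apply hP hsum n i]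
    exact Finset.sum_le_sum fun v _ => mul_le_of_le_one_right (pow_nonneg_apply hP n i v)
      (survival_le_one (kronecker_self_nonneg hP) (sum_kronecker_self hsum) _ _)
  induction k generalizing i with
  | zero =>
    by_cases hi : i ∈ recurrentSet P
    · exact hrec 0 hi
    · exact (uncoupled_zero n hi).le
  | succ k ih =>
    by_cases hi : i ∈ recurrentSet P
    · exact hrec _ hi
    · rw [uncoupled_succ n k hi, ← hsum i]
      refine Finset.sum_le_sum fun j _ => mul_le_of_le_one_right (hP i j) (ih j ?_)
      intro k hj
      rw [uncoupled_of_mem n k hj, ← sum_pow_apply hP hsum n j]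
      exact Finset.sum_le_sum fun v _ => mul_le_of_le_one_right (pow_nonneg_apply hP n j v)
        (survival_le_one (kronecker_self_nonneg hP) (sum_kronecker_self hsum) _ _)

theorem uncoupled_antitone (n : ℕ) (i : V) : Antitone fun k => uncoupled P n k i := by
  refine antitone_nat_of_succ_le fun k => ?_
  have hrec : ∀ k i, i ∈ recurrentSet P → uncoupled P n (k + 1) i ≤ uncoupled P n k i := by
    intro k i hi
    rw [uncoupled_of_mem n _ hi, uncoupled_of_mem n _ hi]
    exact Finset.sum_le_sum fun v _ => mul_le_mul_of_nonneg_left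
      (survival_succ_le (kronecker_self_nonneg hP) (sum_kronecker_self hsum) k _)
      (pow_nonneg_apply hP n i v)
  induction k generalizing i with
  | zero =>
    by_cases hi : i ∈ recurrentSet P
    · exact hrec 0 i hi
    · rw [uncoupled_zero n hi]
      exact uncoupled_le_one hP hsum n _ i
  | succ k ih =>
    by_cases hi : i ∈ recurrentSet P
    · exact hrec _ i hi
    · rw [uncoupled_succ n _ hi, uncoupled_succ n _ hi]
      exact Finset.sum_le_sum fun j _ => mul_le_mul_of_nonneg_left (ih j) (hP i j)

/-- The expected time until the coupling is at most the sum of the expected times until the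
absorption and until the meeting of two walks in a closed component. -/
theorem sum_uncoupled_le {n : ℕ} {L : ℝ} (hL0 : 0 ≤ L)
    (hL : ∀ S, IsClosedComponent (matrixGraph P) S → ∀ u ∈ S, ∀ v ∈ S, ∀ N,
      ∑ k ∈ Finset.range N, survival (P ⊗ₖ P) (Set.diagonal V) k (u, v) ≤ L) (N : ℕ) (i : V) :
    ∑ k ∈ Finset.range N, uncoupled P n k i ≤
      L + ∑ k ∈ Finset.range N, survival P (recurrentSet P) k i := by
  have hrec : ∀ N i, i ∈ recurrentSet P → ∑ k ∈ Finset.range N, uncoupled P n k i ≤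
      L + ∑ k ∈ Finset.range N, survival P (recurrentSet P) k i := by
    rintro N i ⟨S, hS, hiS⟩
    have hi : i ∈ recurrentSet P := ⟨S, hS, hiS⟩
    simp only [survival_of_mem hi, Finset.sum_const_zero, add_zero, uncoupled_of_mem n _ hi]
    rw [Finset.sum_comm]
    calc ∑ v, ∑ k ∈ Finset.range N, (P ^ n) i v * survival (P ⊗ₖ P) (Set.diagonal V) k (i, v)
        ≤ ∑ v, (P ^ n) i v * L := by
          refine Finset.sum_le_sum fun v _ => ?_
          rw [← Finset.mul_sum]
          by_cases h0 : (P ^ n) i v = 0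
          · simp [h0]
          · exact mul_le_mul_of_nonneg_left
              (hL S hS i hiS v (hS.mem_of_pow_ne_zero hP hiS h0) N) (pow_nonneg_apply hP n i v)
      _ = L := by rw [← Finset.sum_mul, sum_pow_apply hP hsum, one_mul]
  induction N generalizing i with
  | zero => simpa using hL0
  | succ N ih =>
    by_cases hi : i ∈ recurrentSet P
    · exact hrec _ i hi
    -- At a transient node both time-`0` terms equal `1` and cancel. Averaging the remaining terms
    -- over the first step preserves the constant `L`.
    · rw [Finset.sum_range_succ', Finset.sum_range_succ', uncoupled_zero n hi, survival_zero hi,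
        ← add_assoc]
      refine add_le_add_left ?_ 1
      simp only [uncoupled_succ n _ hi, survival_succ hi]
      rw [Finset.sum_comm, Finset.sum_comm (s := Finset.range N)]
      simp only [← Finset.mul_sum]
      calc ∑ j, P i j * ∑ k ∈ Finset.range N, uncoupled P n k j
          ≤ ∑ j, P i j * (L + ∑ k ∈ Finset.range N, survival P (recurrentSet P) k j) :=
            Finset.sum_le_sum fun j _ => mul_le_mul_of_nonneg_left (ih j) (hP i j)
        _ = L + ∑ j, P i j * ∑ k ∈ Finset.range N, survival P (recurrentSet P) k j := by
            simp only [mul_add, Finset.sum_add_distrib, ← Finset.sum_mul, hsum, one_mul]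

theorem pow_mulVec_mem_Icc {x : V → ℝ} (hx : ∀ i, x i ∈ Set.Icc (0 : ℝ) 1) (k : ℕ) (i : V) :
    (P ^ k *ᵥ x) i ∈ Set.Icc (0 : ℝ) 1 := by
  refine ⟨Finset.sum_nonneg fun j _ => mul_nonneg (pow_nonneg_apply hP k i j) (hx j).1, ?_⟩
  rw [← sum_pow_apply hP hsum k i]
  exact Finset.sum_le_sum fun j _ =>
    mul_le_of_le_one_right (pow_nonneg_apply hP k i j) (hx j).2

/-- The difference of two entries evolves by averaging under the pair chain, vanishes on the
diagonal and is at most `1` elsewhere, so only pairs that have not met contribute. -/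
theorem abs_pow_mulVec_sub_le {x : V → ℝ} (hx : ∀ i, x i ∈ Set.Icc (0 : ℝ) 1) (k : ℕ) (u v : V) :
    |(P ^ k *ᵥ x) u - (P ^ k *ᵥ x) v| ≤ survival (P ⊗ₖ P) (Set.diagonal V) k (u, v) := by
  induction k generalizing u v with
  | zero =>
    by_cases huv : u = v
    · have hmem : (u, v) ∈ Set.diagonal V := huv
      simp [huv, survival_of_mem]
    · have hmem : (u, v) ∉ Set.diagonal V := huv
      rw [survival_zero hmem, pow_zero, Matrix.one_mulVec, abs_le]
      constructor <;> linarith [(hx u).1, (hx u).2, (hx v).1, (hx v).2]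
  | succ k ih =>
    by_cases huv : u = v
    · have hmem : (u, v) ∈ Set.diagonal V := huv
      simp [huv, survival_of_mem]
    · have hmem : (u, v) ∉ Set.diagonal V := huv
      set y := P ^ k *ᵥ x with hy
      have hstep : ∀ w, (P ^ (k + 1) *ᵥ x) w = ∑ a, P w a * y a := by
        intro w
        rw [pow_succ', ← Matrix.mulVec_mulVec]
        rfl
      have hdiff : (P ^ (k + 1) *ᵥ x) u - (P ^ (k + 1) *ᵥ x) v =
          ∑ a, ∑ b, P u a * P v b * (y a - y b) := by
        have h1 : ∑ a, ∑ b, P u a * P v b * y a = ∑ a, P u a * y a := by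
          refine Finset.sum_congr rfl fun a _ => ?_
          rw [← Finset.sum_mul, ← Finset.mul_sum, hsum, mul_one]
        have h2 : ∑ a, ∑ b, P u a * P v b * y b = ∑ b, P v b * y b := by
          simp only [mul_assoc, ← Finset.mul_sum]
          rw [← Finset.sum_mul, hsum, one_mul]
        simp only [mul_sub, Finset.sum_sub_distrib, h1, h2, hstep]
      rw [hdiff, survival_succ hmem, Fintype.sum_prod_type]
      refine (Finset.abs_sum_le_sum_abs _ _).trans (Finset.sum_le_sum fun a _ => ?_)
      refine (Finset.abs_sum_le_sum_abs _ _).trans (Finset.sum_le_sum fun b _ => ?_)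
      rw [abs_mul, abs_of_nonneg (mul_nonneg (hP u a) (hP v b))]
      exact mul_le_mul_of_nonneg_left (ih a b) (mul_nonneg (hP u a) (hP v b))

/-- At a recurrent node the `n` extra steps are made first, which leaves a comparison of entries of
the same vector `P ^ k *ᵥ x`. At a transient node both walks take the same step. -/
theorem abs_pow_add_mulVec_sub_le {x : V → ℝ} (hx : ∀ i, x i ∈ Set.Icc (0 : ℝ) 1) (n k : ℕ)
    (i : V) : |(P ^ (k + n) *ᵥ x) i - (P ^ k *ᵥ x) i| ≤ uncoupled P n k i := by
  have hrec : ∀ k i, i ∈ recurrentSet P →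
      |(P ^ (k + n) *ᵥ x) i - (P ^ k *ᵥ x) i| ≤ uncoupled P n k i := by
    intro k i hi
    have hdiff : (P ^ (k + n) *ᵥ x) i - (P ^ k *ᵥ x) i =
        ∑ v, (P ^ n) i v * ((P ^ k *ᵥ x) v - (P ^ k *ᵥ x) i) := by
      simp only [mul_sub, Finset.sum_sub_distrib, ← Finset.sum_mul, sum_pow_apply hP hsum,
        one_mul]
      rw [add_comm, pow_add, ← Matrix.mulVec_mulVec]
      rfl
    rw [hdiff, uncoupled_of_mem n k hi]
    refine (Finset.abs_sum_le_sum_abs _ _).trans (Finset.sum_le_sum fun v _ => ?_)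
    rw [abs_mul, abs_of_nonneg (pow_nonneg_apply hP n i v), abs_sub_comm]
    exact mul_le_mul_of_nonneg_left (abs_pow_mulVec_sub_le hP hsum hx k i v)
      (pow_nonneg_apply hP n i v)
  induction k generalizing i with
  | zero =>
    by_cases hi : i ∈ recurrentSet P
    · exact hrec 0 i hi
    · have h1 := pow_mulVec_mem_Icc hP hsum hx (0 + n) i
      have h2 := pow_mulVec_mem_Icc hP hsum hx 0 i
      rw [uncoupled_zero n hi, abs_le]
      constructor <;> linarith [h1.1, h1.2, h2.1, h2.2]
  | succ k ih =>
    by_cases hi : i ∈ recurrentSet P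
    · exact hrec _ i hi
    · have hdiff : (P ^ (k + 1 + n) *ᵥ x) i - (P ^ (k + 1) *ᵥ x) i =
          ∑ j, P i j * ((P ^ (k + n) *ᵥ x) j - (P ^ k *ᵥ x) j) := by
        simp only [mul_sub, Finset.sum_sub_distrib]
        rw [add_right_comm, pow_succ', pow_succ', ← Matrix.mulVec_mulVec, ← Matrix.mulVec_mulVec]
        rfl
      rw [hdiff, uncoupled_succ n k hi]
      refine (Finset.abs_sum_le_sum_abs _ _).trans (Finset.sum_le_sum fun j _ => ?_)
      rw [abs_mul, abs_of_nonneg (hP i j)]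
      exact mul_le_mul_of_nonneg_left (ih j) (hP i j)

omit hP hsum in
/-- The last of finitely many terms of an antitone sequence is at most their average. -/
theorem le_div_of_sum_range_le {a : ℕ → ℝ} (ha : Antitone a) {M : ℝ} {t : ℕ}
    (h : ∑ k ∈ Finset.range (t + 1), a k ≤ M) : a t ≤ M / (t + 1) := by
  rw [le_div_iff₀ (by positivity)]
  calc a t * (t + 1) = ∑ _k ∈ Finset.range (t + 1), a t := by simp [mul_comm]
    _ ≤ ∑ k ∈ Finset.range (t + 1), a k :=
        Finset.sum_le_sum fun k hk => ha (Nat.le_of_lt_succ (Finset.mem_range.1 hk))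
    _ ≤ M := h

/-- Markov's inequality over the `t + 1` times `0, …, t` bounds one block. A restart may find a
recurrent pair, with mean at most `L`, or a node still on its way, with mean at most `L + H`; the
larger bound covers both. -/
theorem uncoupled_mul_le_pow {n : ℕ} {L H : ℝ} (hL0 : 0 ≤ L) (hH0 : 0 ≤ H)
    (hL : ∀ S, IsClosedComponent (matrixGraph P) S → ∀ u ∈ S, ∀ v ∈ S, ∀ N,
      ∑ k ∈ Finset.range N, survival (P ⊗ₖ P) (Set.diagonal V) k (u, v) ≤ L)
    (hH : ∀ i N, ∑ k ∈ Finset.range N, survival P (recurrentSet P) k i ≤ H) (t j : ℕ) (i : V) :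
    uncoupled P n (j * t) i ≤ ((L + H) / (t + 1)) ^ j := by
  induction j with
  | zero => simpa using uncoupled_le_one hP hsum n 0 i
  | succ j ih =>
    rw [add_mul, one_mul, pow_succ']
    refine (uncoupled_add_le hP (b := (L + H) / (t + 1)) ?_ ?_ (j * t) i).trans
      (mul_le_mul_of_nonneg_left ih (by positivity))
    · intro S hS u hu v hv
      exact le_div_of_sum_range_le
        (survival_antitone (kronecker_self_nonneg hP) (sum_kronecker_self hsum) (u, v))
        ((hL S hS u hu v hv _).trans (le_add_of_nonneg_right hH0))
    · intro i
      exact le_div_of_sum_range_le (uncoupled_antitone hP hsum n i)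
        ((sum_uncoupled_le hP hsum hL0 hL _ i).trans (by linarith [hH i (t + 1)]))

omit hP hsum in
/-- After `4 M log (1 / ε)` steps one can choose `j` restarts, each after `t` steps, such that the
Markov bound `M / (t + 1)` for a single one yields `ε` in total. -/
theorem exists_restart_schedule {M ε : ℝ} {k : ℕ} (hM : 0 ≤ M) (hε0 : 0 < ε) (hε : ε ≤ 1 / 2)
    (hk : 4 * M * Real.log (1 / ε) ≤ k) : ∃ j t : ℕ, j * t ≤ k ∧ (M / (t + 1)) ^ j ≤ ε := by
  set a := Real.log (1 / ε) with ha
  have hlog2 := Real.log_two_gt_d9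
  have ha2 : Real.log 2 ≤ a := by
    refine Real.log_le_log two_pos ?_
    rw [le_div_iff₀ hε0]
    linarith
  have ha0 : 0 < a := by linarith
  have hεa : ε = Real.exp (-a) := by
    rw [ha, one_div, Real.log_inv, neg_neg, Real.exp_log hε0]
  set j := ⌈a⌉₊ with hj
  have hja : a ≤ j := Nat.le_ceil a
  have hj0 : 0 < j := Nat.ceil_pos.2 ha0
  -- Rounding up at most doubles `a`: if `a ≤ 1` then `j = 1`, and `a ≥ log 2 > 1 / 2` because `ε ≤
  -- 1 / 2`.
  have hj2 : (j : ℝ) ≤ 2 * a := by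
    rcases le_or_gt a 1 with h1 | h1
    · have : j ≤ 1 := Nat.ceil_le.2 (by simpa using h1)
      have : (j : ℝ) ≤ 1 := by exact_mod_cast this
      linarith
    · have := Nat.ceil_lt_add_one ha0.le
      linarith
  refine ⟨j, k / j, Nat.mul_div_le k j, ?_⟩
  -- This bounds the ratio of one block, with `t = k / j`: `4 * a * M ≤ k ≤ j * (t + 1)`. From `a ≤
  -- j ≤ 2 * a` it lies in `[1 / 4, 1 / 2]`.
  set y : ℝ := j / (4 * a) with hy
  have hjy : (j : ℝ) = 4 * a * y := by rw [hy]; field_simp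
  have hy1 : 1 / 4 ≤ y := by rw [hy, le_div_iff₀ (by positivity)]; linarith
  have hy2 : y ≤ 1 / 2 := by rw [hy, div_le_iff₀ (by positivity)]; linarith
  have hMy : M / ((k / j : ℕ) + 1) ≤ y := by
    have hkj : (k : ℝ) ≤ j * ((k / j : ℕ) + 1) := by
      exact_mod_cast (Nat.lt_mul_div_succ k hj0).le
    rw [div_le_iff₀ (by positivity)]
    refine le_of_mul_le_mul_left ?_ (show 0 < 4 * a by positivity)
    calc 4 * a * M = 4 * M * a := by ring
      _ ≤ k := hk
      _ ≤ j * ((k / j : ℕ) + 1) := hkj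
      _ = 4 * a * (y * ((k / j : ℕ) + 1)) := by rw [← mul_assoc, ← hjy]
  have hy0 : 0 < y := by linarith
  have hlogy : Real.log y ≤ 2 * y - 1 - Real.log 2 := by
    have := Real.log_le_sub_one_of_pos (show 0 < 2 * y by positivity)
    rw [Real.log_mul two_ne_zero hy0.ne'] at this
    linarith
  calc (M / ((k / j : ℕ) + 1)) ^ j ≤ y ^ j := pow_le_pow_left₀ (by positivity) hMy j
    _ = Real.exp (j * Real.log y) := by
        rw [mul_comm, Real.exp_mul, Real.exp_log hy0, Real.rpow_natCast]
    _ ≤ ε := by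
        rw [hεa, Real.exp_le_exp]
        -- The tangent to `log` at `1 / 2` gives a quadratic upper bound, convex in `y` and below
        -- `-1` at both `1 / 4` and `1 / 2`.
        have h1 : 4 * y * Real.log y ≤ -1 := by
          have h2 : 4 * y * Real.log y ≤ 4 * y * (2 * y - 1 - Real.log 2) :=
            mul_le_mul_of_nonneg_left hlogy (by positivity)
          nlinarith [mul_nonneg (sub_nonneg.2 hy1) (sub_nonneg.2 hy2)]
        calc (j : ℝ) * Real.log y = a * (4 * y * Real.log y) := by rw [hjy]; ring
          _ ≤ a * (-1) := mul_le_mul_of_nonneg_left h1 ha0.le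
          _ = -a := by ring

theorem abs_pow_add_mulVec_sub_le_of_log_le {L H : ℝ} (hL0 : 0 ≤ L) (hH0 : 0 ≤ H)
    (hL : ∀ S, IsClosedComponent (matrixGraph P) S → ∀ u ∈ S, ∀ v ∈ S, ∀ N,
      ∑ k ∈ Finset.range N, survival (P ⊗ₖ P) (Set.diagonal V) k (u, v) ≤ L)
    (hH : ∀ i N, ∑ k ∈ Finset.range N, survival P (recurrentSet P) k i ≤ H)
    {x : V → ℝ} (hx : ∀ i, x i ∈ Set.Icc (0 : ℝ) 1) {ε : ℝ} {k : ℕ} (hε0 : 0 < ε)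
    (hε : ε ≤ 1 / 2) (hk : 4 * (L + H) * Real.log (1 / ε) ≤ k) (n : ℕ) (i : V) :
    |(P ^ (k + n) *ᵥ x) i - (P ^ k *ᵥ x) i| ≤ ε := by
  obtain ⟨j, t, hjt, hle⟩ := exists_restart_schedule (add_nonneg hL0 hH0) hε0 hε hk
  exact (abs_pow_add_mulVec_sub_le hP hsum hx n k i).trans
    ((uncoupled_antitone hP hsum n i hjt).trans
      ((uncoupled_mul_le_pow hP hsum hL0 hH0 hL hH t j i).trans hle))

/-- The powers of the transition matrix converge on bounded vectors, with the rate of the coupling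
bound. -/
theorem exists_tendsto_pow_mulVec {L H : ℝ} (hL0 : 0 ≤ L) (hH0 : 0 ≤ H)
    (hL : ∀ S, IsClosedComponent (matrixGraph P) S → ∀ u ∈ S, ∀ v ∈ S, ∀ N,
      ∑ k ∈ Finset.range N, survival (P ⊗ₖ P) (Set.diagonal V) k (u, v) ≤ L)
    (hH : ∀ i N, ∑ k ∈ Finset.range N, survival P (recurrentSet P) k i ≤ H)
    {x : V → ℝ} (hx : ∀ i, x i ∈ Set.Icc (0 : ℝ) 1) :
    ∃ xInf : V → ℝ, Tendsto (fun k : ℕ => P ^ k *ᵥ x) atTop (𝓝 xInf) ∧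
      ∀ (ε : ℝ) (k : ℕ), 0 < ε → ε ≤ 1 / 2 → 4 * (L + H) * Real.log (1 / ε) ≤ k →
        ∀ i, |(P ^ k *ᵥ x) i - xInf i| ≤ ε := by
  have hlim : ∀ i, ∃ l, Tendsto (fun k : ℕ => (P ^ k *ᵥ x) i) atTop (𝓝 l) := by
    intro i
    refine cauchySeq_tendsto_of_complete (Metric.cauchySeq_iff'.2 fun ε hε => ?_)
    -- Halving yields the strict inequality of the Cauchy criterion; the cap meets the requirement
    -- of the rate.
    set δ := min (ε / 2) (1 / 2) with hδ
    have hδ0 : 0 < δ := lt_min (by linarith) (by norm_num)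
    obtain ⟨k, hk⟩ := exists_nat_ge (4 * (L + H) * Real.log (1 / δ))
    refine ⟨k, fun N hN => ?_⟩
    obtain ⟨n, rfl⟩ := Nat.exists_eq_add_of_le hN
    have h1 := abs_pow_add_mulVec_sub_le_of_log_le hP hsum hL0 hH0 hL hH hx hδ0
      (min_le_right _ _) hk n i
    rw [Real.dist_eq]
    linarith [min_le_left (ε / 2) (1 / 2)]
  choose xInf hxInf using hlim
  refine ⟨xInf, tendsto_pi_nhds.2 hxInf, fun ε k hε0 hε hk i => ?_⟩
  rw [abs_sub_comm]
  have hshift : Tendsto (fun n : ℕ => |(P ^ (k + n) *ᵥ x) i - (P ^ k *ᵥ x) i|) atTop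
      (𝓝 |xInf i - (P ^ k *ᵥ x) i|) := by
    have := (tendsto_add_atTop_iff_nat k).2 (hxInf i)
    simp only [add_comm _ k] at this
    exact (this.sub_const _).abs
  exact le_of_tendsto' hshift fun n =>
    abs_pow_add_mulVec_sub_le_of_log_le hP hsum hL0 hH0 hL hH hx hε0 hε hk n i

/-- The distributions of the random walk converge in total variation, with the rate of the coupling
bound. -/
theorem exists_tendsto_vecMul_pow {L H : ℝ} (hL0 : 0 ≤ L) (hH0 : 0 ≤ H)
    (hL : ∀ S, IsClosedComponent (matrixGraph P) S → ∀ u ∈ S, ∀ v ∈ S, ∀ N,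
      ∑ k ∈ Finset.range N, survival (P ⊗ₖ P) (Set.diagonal V) k (u, v) ≤ L)
    (hH : ∀ i N, ∑ k ∈ Finset.range N, survival P (recurrentSet P) k i ≤ H)
    {v : V → ℝ} (hv : v ∈ stdSimplex ℝ V) :
    ∃ vInf : V → ℝ, Tendsto (fun k : ℕ => v ᵥ* P ^ k) atTop (𝓝 vInf) ∧
      ∀ (ε : ℝ) (k : ℕ), 0 < ε → ε ≤ 1 / 2 → 4 * (L + H) * Real.log (1 / ε) ≤ k →
        tvDist (v ᵥ* P ^ k) vInf ≤ ε := by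
  let ind : Finset V → V → ℝ := fun B i => if i ∈ B then 1 else 0
  have hind : ∀ B i, ind B i ∈ Set.Icc (0 : ℝ) 1 := by
    intro B i
    simp only [ind]
    split_ifs <;> norm_num
  -- Duality: the mass of an event under `v ᵥ* P ^ k` is the `v`-average of the evolved indicator.
  have hsumB : ∀ (B : Finset V) (k : ℕ), ∑ i ∈ B, (v ᵥ* P ^ k) i = v ⬝ᵥ (P ^ k *ᵥ ind B) := by
    intro B k
    rw [Matrix.dotProduct_mulVec]
    simp [dotProduct, ind]
  choose xInf hlim hrate using fun B =>
    exists_tendsto_pow_mulVec hP hsum hL0 hH0 hL hH (hind B)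
  have hlimB : ∀ B : Finset V, Tendsto (fun k : ℕ => ∑ i ∈ B, (v ᵥ* P ^ k) i) atTop
      (𝓝 (v ⬝ᵥ xInf B)) := by
    intro B
    simp only [hsumB]
    exact tendsto_finsetSum _ fun i _ => ((tendsto_pi_nhds.1 (hlim B)) i).const_mul (v i)
  have hcoord : Tendsto (fun k : ℕ => v ᵥ* P ^ k) atTop (𝓝 fun i => v ⬝ᵥ xInf {i}) :=
    tendsto_pi_nhds.2 fun i => by simpa using hlimB {i}
  refine ⟨_, hcoord, fun ε k hε0 hε hk => ciSup_le fun B => ?_⟩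
  -- The limits for different events were chosen separately; uniqueness of limits makes them
  -- additive.
  have hB : ∑ i ∈ B, v ⬝ᵥ xInf {i} = v ⬝ᵥ xInf B :=
    tendsto_nhds_unique (tendsto_finsetSum B fun i _ => (tendsto_pi_nhds.1 hcoord) i) (hlimB B)
  rw [hB, hsumB, ← dotProduct_sub]
  calc |v ⬝ᵥ (P ^ k *ᵥ ind B - xInf B)| ≤ ∑ i, v i * ε := by
        refine (Finset.abs_sum_le_sum_abs _ _).trans (Finset.sum_le_sum fun i _ => ?_)
        rw [abs_mul, abs_of_nonneg (hv.1 i)]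
        exact mul_le_mul_of_nonneg_left (hrate B ε k hε0 hε hk i) (hv.1 i)
    _ = ε := by rw [← Finset.sum_mul, hv.2, one_mul]

end Mixing

/-! ### Finiteness of `L` and `H` and their bounds on survival sums -/

section ExpectedTimes

variable {V : Type*} [Fintype V] [DecidableEq V] [MeasurableSpace V] [MeasurableSingletonClass V]
  {P : Matrix V V ℝ} (hP : P ∈ Matrix.rowStochastic ℝ V)

theorem tsum_ofReal_le_of_sum_range_le {a : ℕ → ℝ} (ha : ∀ k, 0 ≤ a k) {B : ℝ}
    (h : ∀ N, ∑ k ∈ Finset.range N, a k ≤ B) :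
    ∑' k, ENNReal.ofReal (a k) ≤ ENNReal.ofReal B := by
  refine ENNReal.tsum_le_of_sum_range_le fun N => ?_
  rw [← ENNReal.ofReal_sum_of_nonneg fun k _ => ha k]
  exact ENNReal.ofReal_le_ofReal (h N)

theorem sum_range_le_toReal_of_tsum_ofReal_le {a : ℕ → ℝ} (ha : ∀ k, 0 ≤ a k) {b : ℝ≥0∞}
    (hb : b ≠ ⊤) (h : ∑' k, ENNReal.ofReal (a k) ≤ b) (N : ℕ) :
    ∑ k ∈ Finset.range N, a k ≤ b.toReal := by
  rw [← ENNReal.ofReal_le_iff_le_toReal hb, ENNReal.ofReal_sum_of_nonneg fun k _ => ha k]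
  exact (ENNReal.sum_le_tsum _).trans h

theorem maxAbsorptionTime_lt_top : maxAbsorptionTime P hP < ⊤ := by
  obtain ⟨h0, h1⟩ := Matrix.mem_rowStochastic_iff_sum.1 hP
  obtain ⟨B, hB⟩ := exists_sum_survival_recurrentSet_le h0 h1
  refine lt_of_le_of_lt (iSup_le fun i => ?_) (ENNReal.ofReal_lt_top (r := B))
  rw [lintegral_absorptionTime]
  exact tsum_ofReal_le_of_sum_range_le (fun k => survival_nonneg h0 k i) (hB i)

theorem maxCouplingTime_lt_top
    (hap : ∀ S, IsClosedComponent (matrixGraph P) S → IsAperiodic (matrixGraph P) S) :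
    maxCouplingTime P hP < ⊤ := by
  obtain ⟨h0, h1⟩ := Matrix.mem_rowStochastic_iff_sum.1 hP
  obtain ⟨B, hB⟩ := exists_sum_survival_diagonal_le h0 h1 hap
  refine lt_of_le_of_lt (iSup₂_le fun S hS => iSup₂_le fun u hu => iSup₂_le fun v hv => ?_)
    (ENNReal.ofReal_lt_top (r := B))
  rw [lintegral_couplingTime]
  exact tsum_ofReal_le_of_sum_range_le
    (fun k => survival_nonneg (kronecker_self_nonneg h0) k (u, v)) (hB S hS u hu v hv)

theorem sum_survival_le_maxAbsorptionTime (i : V) (N : ℕ) :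
    ∑ k ∈ Finset.range N, survival P (recurrentSet P) k i ≤ (maxAbsorptionTime P hP).toReal := by
  have h0 := (Matrix.mem_rowStochastic_iff_sum.1 hP).1
  refine sum_range_le_toReal_of_tsum_ofReal_le (fun k => survival_nonneg h0 k i)
    (maxAbsorptionTime_lt_top hP).ne ?_ N
  exact (lintegral_absorptionTime hP i).ge.trans
    (le_iSup (fun i => ∫⁻ X, absorptionTime (matrixGraph P) X ∂(walkLaw P hP i)) i)

theorem sum_survival_le_maxCouplingTime
    (hap : ∀ S, IsClosedComponent (matrixGraph P) S → IsAperiodic (matrixGraph P) S) {S : Set V}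
    (hS : IsClosedComponent (matrixGraph P) S) {u v : V} (hu : u ∈ S) (hv : v ∈ S) (N : ℕ) :
    ∑ k ∈ Finset.range N, survival (P ⊗ₖ P) (Set.diagonal V) k (u, v) ≤
      (maxCouplingTime P hP).toReal := by
  have h0 := (Matrix.mem_rowStochastic_iff_sum.1 hP).1
  refine sum_range_le_toReal_of_tsum_ofReal_le
    (fun k => survival_nonneg (kronecker_self_nonneg h0) k (u, v))
    (maxCouplingTime_lt_top hP hap).ne ?_ N
  rw [← lintegral_couplingTime hP u v]
  exact le_iSup₂_of_le S hS (le_iSup₂_of_le u hu (le_iSup₂_of_le v hv le_rfl))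

end ExpectedTimes

end BeliefSystem

/-! ### The theorem for the belief system -/

theorem mainTheorem4 (n m : ℕ)
    (A : Matrix (Fin n) (Fin n) ℝ) (C : Matrix (Fin m) (Fin m) ℝ) (lam : Fin n → ℝ)
    (hA : A ∈ Matrix.rowStochastic ℝ (Fin n)) (hC : C ∈ Matrix.rowStochastic ℝ (Fin m))
    (hlam : ∀ i, lam i ∈ Set.Icc (0 : ℝ) 1)
    (hap : ∀ S, IsClosedComponent (matrixGraph (systemMatrix A C lam)) S →
      IsAperiodic (matrixGraph (systemMatrix A C lam)) S) :
    maxCouplingTime (systemMatrix A C lam) (systemMatrix_mem hA hC hlam) < ⊤ ∧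
    maxAbsorptionTime (systemMatrix A C lam) (systemMatrix_mem hA hC hlam) < ⊤ ∧
    (∀ v ∈ stdSimplex ℝ (Node n m), ∃ vInf : Node n m → ℝ,
      Tendsto (fun k : ℕ => v ᵥ* systemMatrix A C lam ^ k) atTop (𝓝 vInf) ∧
      ∀ (ε : ℝ) (k : ℕ), 0 < ε → ε ≤ 1 / 2 →
        4 * ((maxCouplingTime (systemMatrix A C lam) (systemMatrix_mem hA hC hlam)).toReal +
          (maxAbsorptionTime (systemMatrix A C lam) (systemMatrix_mem hA hC hlam)).toReal) *
            Real.log (1 / ε) ≤ k →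
        tvDist (v ᵥ* systemMatrix A C lam ^ k) vInf ≤ ε) ∧
    (∀ x : ℕ → Node n m → ℝ, (∀ i, x 0 i ∈ Set.Icc (0 : ℝ) 1) →
      (∀ k, x (k + 1) = systemMatrix A C lam *ᵥ x k) → ∃ xInf : Node n m → ℝ,
      Tendsto x atTop (𝓝 xInf) ∧
      ∀ (ε : ℝ) (k : ℕ), 0 < ε → ε ≤ 1 / 2 →
        4 * ((maxCouplingTime (systemMatrix A C lam) (systemMatrix_mem hA hC hlam)).toReal +
          (maxAbsorptionTime (systemMatrix A C lam) (systemMatrix_mem hA hC hlam)).toReal) *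
            Real.log (1 / ε) ≤ k →
        ∀ i, |x k i - xInf i| ≤ ε) := by
  have hP := systemMatrix_mem hA hC hlam
  obtain ⟨h0, h1⟩ := Matrix.mem_rowStochastic_iff_sum.1 hP
  have hL : ∀ S, IsClosedComponent (matrixGraph (systemMatrix A C lam)) S → ∀ u ∈ S, ∀ v ∈ S,
      ∀ N, ∑ k ∈ Finset.range N, survival (systemMatrix A C lam ⊗ₖ systemMatrix A C lam)
        (Set.diagonal (Node n m)) k (u, v) ≤
          (maxCouplingTime (systemMatrix A C lam) (systemMatrix_mem hA hC hlam)).toReal :=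
    fun S hS u hu v hv N => sum_survival_le_maxCouplingTime hP hap hS hu hv N
  have hH := sum_survival_le_maxAbsorptionTime hP
  refine ⟨maxCouplingTime_lt_top hP hap, maxAbsorptionTime_lt_top hP, fun v hv =>
    exists_tendsto_vecMul_pow h0 h1 ENNReal.toReal_nonneg ENNReal.toReal_nonneg hL hH hv,
    fun x hx hstep => ?_⟩
  have hxk : ∀ k, x k = systemMatrix A C lam ^ k *ᵥ x 0 := by
    intro k
    induction k with
    | zero => simp
    | succ k ih => rw [hstep, ih, Matrix.mulVec_mulVec, ← pow_succ']
  obtain ⟨xInf, hlim, hrate⟩ := exists_tendsto_pow_mulVec h0 h1 ENNReal.toReal_nonneg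
    ENNReal.toReal_nonneg hL hH hx
  refine ⟨xInf, by simpa only [← hxk] using hlim, fun ε k hε0 hε hk i => ?_⟩
  rw [hxk]
  exact hrate ε k hε0 hε hk i
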